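/- Let $0<\alpha\le 1$, let $E,A\in\mathbb{R}^{n\times n}$ with $\operatorname{rank}(E)=r<n$, and let $B\in\mathbb{R}^{n\times m}$, $C\in\mathbb{R}^{p\times n}$. Write $\operatorname{sym}(M)=M^{\rm T}+M$, let $<0$ and $>0$ mean (symmetric and) negative, respectively positive, definite, and set \[ \mathbb{P}_\alpha^{n\times n}=\Big\{\sin\big(\tfrac{\alpha\pi}{2}\big)X+\cos\big(\tfrac{\alpha\pi}{2}\big)Y : X,Y\in\mathbb{R}^{n\times n},\ \begin{bmatrix}X&Y\\-Y&X\end{bmatrix}>0\Big\}. \] For a real $n\times n$ matrix $\tilde A$, the system $E\mathscr{D}^\alpha x=\tilde A x$ is called admissible if $\det(sE-\tilde A)\not\equiv 0$ for $s\in\mathbb{C}$ (regular), $\deg\det(sE-\tilde A)=\operatorname{rank}(E)$ (impulse free), and every complex root $\lambda$ of $\det(\lambda E-\tilde A)=0$ is nonzero and satisfies $|\arg\lambda|>\alpha\pi/2$, where $\arg\lambda\in(-\pi,\pi]$ (stable). Let $E_1\in\mathbb{R}^{n\times(n-r)}$ and $E_2\in\mathbb{R}^{(n-r)\times n}$ be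 any matrices with $\operatorname{rank}(E_1)=\operatorname{rank}(E_2)=n-r$, $EE_1=0$ and $E_2E=0$. Then, for every $F\in\mathbb{R}^{m\times p}$, the static output feedback $u=Fy$ makes the closed-loop system $E\mathscr{D}^\alpha x=(A+BFC)x$ admissible if and only if there exist $X\in\mathbb{P}_\alpha^{n\times n}$, $Y\in\mathbb{R}^{(n-r)\times n}$, $Z\in\mathbb{R}^{m\times n}$ satisfying \[ \operatorname{sym}\big(AXE^{\rm T}+AE_1Y+BZ\big)<0 \] with $XE^{\rm T}+E_1Y$ invertible, and, for the intermediate gain $K_0=Z(XE^{\rm T}+E_1Y)^{-1}$, there exist $P\in\mathbb{P}_\alpha^{n\times n}$, $Q\in\mathbb{R}^{n\times(n-r)}$, $G\in\mathbb{R}^{m\times m}$ and $H\in\mathbb{R}^{m\times p}$ satisfying \[ \begin{bmatrix}\Phi & (E^{\rm T}P+QE_2)B+C^{\rm T}H^{\rm T}-K_0^{\rm T}G^{\rm T}\\ * & -G-G^{\rm T}\end{bmatrix}<0,\qquad \Phi=\operatorname{sym}\big(E^{\rm T}P(A+BK_0)+QE_2(A+BK_0)\big), \] where $*$ denotes the transpose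 of the upper right block, such that $F=G^{-1}H$. (The last inequality forces $G$ to be invertible, whatever the matrices $K_0,P,Q,H$ are.) -/

import Mathlib

open Matrix

noncomputable section

namespace SingularFOS

/-- `sym M = Mᵀ + M`. -/
def sym {n : ℕ} (M : Matrix (Fin n) (Fin n) ℝ) : Matrix (Fin n) (Fin n) ℝ := Mᵀ + M

/-- `M < 0`: the real matrix `M` is symmetric and negative definite. -/
def NegDef {ι : Type*} (M : Matrix ι ι ℝ) : Prop := (-M).PosDef

/-- The fractional order positive definite matrices: all `sin (απ/2) X + cos (απ/2) Y` with
`X`, `Y` real and the block matrix `[X, Y; -Y, X]` (symmetric) positive definite. -/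
def fracPosDef (n : ℕ) (α : ℝ) : Set (Matrix (Fin n) (Fin n) ℝ) :=
  {P | ∃ X Y : Matrix (Fin n) (Fin n) ℝ,
    (Matrix.fromBlocks X Y (-Y) X).PosDef ∧
      P = Real.sin (α * Real.pi / 2) • X + Real.cos (α * Real.pi / 2) • Y}

/-- The polynomial `det (s E - A)` in the indeterminate `s`. -/
def detPencil {n : ℕ} (E A : Matrix (Fin n) (Fin n) ℝ) : Polynomial ℝ :=
  ((Polynomial.X : Polynomial ℝ) • E.map Polynomial.C - A.map Polynomial.C).det

/-- `{E, A}` is regular: `det (s E - A)` does not vanish identically on `ℂ`. -/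
def IsRegular {n : ℕ} (E A : Matrix (Fin n) (Fin n) ℝ) : Prop :=
  ∃ s : ℂ, Polynomial.aeval s (detPencil E A) ≠ 0

/-- `{E, A}` is impulse free: `deg (det (s E - A)) = rank E`
(the zero polynomial has degree `⊥` here, which is never a rank). -/
def IsImpulseFree {n : ℕ} (E A : Matrix (Fin n) (Fin n) ℝ) : Prop :=
  (detPencil E A).degree = (E.rank : WithBot ℕ)

/-- `{E, A}` is stable (for the order `α`): every finite eigenvalue `z`, that is, every complex
root of `det (z E - A) = 0`, satisfies `|arg z| > απ/2`. Since `Complex.arg 0 = 0`, the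
eigenvalue `0` is not allowed when `0 < α`. -/
def IsStable {n : ℕ} (α : ℝ) (E A : Matrix (Fin n) (Fin n) ℝ) : Prop :=
  ∀ z : ℂ, Polynomial.aeval z (detPencil E A) = 0 → α * Real.pi / 2 < |Complex.arg z|

/-- The singular fractional order system `E D^α x = A x` is admissible. -/
def IsAdmissible {n : ℕ} (α : ℝ) (E A : Matrix (Fin n) (Fin n) ℝ) : Prop :=
  IsRegular E A ∧ IsImpulseFree E A ∧ IsStable α E A

/-- The matrix inequality `sym (A X Eᵀ + A E₁ Y + B Z) < 0`. -/
def StateFeedbackLMI {n m k : ℕ} (E A : Matrix (Fin n) (Fin n) ℝ)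
    (B : Matrix (Fin n) (Fin m) ℝ) (E₁ : Matrix (Fin n) (Fin k) ℝ)
    (X : Matrix (Fin n) (Fin n) ℝ) (Y : Matrix (Fin k) (Fin n) ℝ)
    (Z : Matrix (Fin m) (Fin n) ℝ) : Prop :=
  NegDef (sym (A * X * Eᵀ + A * E₁ * Y + B * Z))

/-- `Φ = sym (Eᵀ P (A + B K₀) + Q E₂ (A + B K₀))`. -/
def Phi {n m k : ℕ} (E A : Matrix (Fin n) (Fin n) ℝ) (B : Matrix (Fin n) (Fin m) ℝ)
    (E₂ : Matrix (Fin k) (Fin n) ℝ) (K₀ : Matrix (Fin m) (Fin n) ℝ)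
    (P : Matrix (Fin n) (Fin n) ℝ) (Q : Matrix (Fin n) (Fin k) ℝ) :
    Matrix (Fin n) (Fin n) ℝ :=
  sym (Eᵀ * P * (A + B * K₀) + Q * E₂ * (A + B * K₀))

/-- The block matrix inequality
`[Φ, (Eᵀ P + Q E₂) B + Cᵀ Hᵀ - K₀ᵀ Gᵀ; *, -G - Gᵀ] < 0`. -/
def OutputFeedbackLMI {n m p k : ℕ} (E A : Matrix (Fin n) (Fin n) ℝ)
    (B : Matrix (Fin n) (Fin m) ℝ) (C : Matrix (Fin p) (Fin n) ℝ)
    (E₂ : Matrix (Fin k) (Fin n) ℝ) (K₀ : Matrix (Fin m) (Fin n) ℝ)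
    (P : Matrix (Fin n) (Fin n) ℝ) (Q : Matrix (Fin n) (Fin k) ℝ)
    (G : Matrix (Fin m) (Fin m) ℝ) (H : Matrix (Fin m) (Fin p) ℝ) : Prop :=
  NegDef (Matrix.fromBlocks
    (Phi E A B E₂ K₀ P Q) ((Eᵀ * P + Q * E₂) * B + Cᵀ * Hᵀ - K₀ᵀ * Gᵀ)
    ((Eᵀ * P + Q * E₂) * B + Cᵀ * Hᵀ - K₀ᵀ * Gᵀ)ᵀ (-G - Gᵀ))

end SingularFOS

end

/-! The core is a Lyapunov criterion: `{E, A}` is admissible iff `sym ((Eᵀ P + Q E₂) A) < 0` for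
some `P` in the fractional class and some `Q`. Put `θ = απ/2` and `c = sin θ + i cos θ`. The sector
`|arg z| > θ` is the union of the half planes `Re (c z) < 0` and `Re (c̄ z) < 0` (`lt_abs_arg_iff`),
and the fractional class consists of the real matrices `c Z + c̄ Zᵀ` with `Z` Hermitian positive
definite (`mem_fracPosDef_iff`).

If the inequality holds, testing it on vectors of `ker E` gives impulse freeness, and testing it on
eigenvectors of the pencil gives stability (`isAdmissible_of_negDef`). Conversely, impulse freeness
brings the pair to `E = W diag(I, 0) S`, `A = W diag(Aᵣ, I) S`. The finite eigenvalues are then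
those of `Aᵣ`, and a two-half-plane Lyapunov theorem for `Aᵣ`, proved over `ℂ` by induction on the
dimension and then made real, supplies `P` and `Q` (`IsAdmissible.exists_negDef_left`).
Transposition gives the dual criterion in `X` and `Y`.

For the feedback, a congruence by `[I, 0; FC - K₀, I]` turns the upper left block of the output
feedback inequality into the criterion for `A + BFC`. In the other direction `K₀ = FC` reduces the
off-diagonal block to `(Eᵀ P + Q E₂) B`, so a large multiple of the identity for `G` suffices by a
Schur complement. -/

namespace SingularFOS

open scoped ComplexOrder

/-! ### Positive definite block matrices and congruence. -/

section Blocks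

variable {𝕜 : Type*} [RCLike 𝕜] {a b : Type*} [Fintype a] [Fintype b]

lemma posDef_fromBlocks_diag {R : Type*} [CommRing R] [PartialOrder R] [StarRing R]
    [IsOrderedAddMonoid R] {A : Matrix a a R} {D : Matrix b b R} (hA : A.PosDef)
    (hD : D.PosDef) : (fromBlocks A 0 0 D).PosDef := by
  refine PosDef.of_dotProduct_mulVec_pos ?_ ?_
  · rw [isHermitian_fromBlocks_iff]
    exact ⟨hA.isHermitian, by simp, by simp, hD.isHermitian⟩
  · intro x hx
    have hx' : x = Sum.elim (x ∘ Sum.inl) (x ∘ Sum.inr) := by simp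
    have key : star x ⬝ᵥ (fromBlocks A 0 0 D *ᵥ x) =
        star (x ∘ Sum.inl) ⬝ᵥ (A *ᵥ (x ∘ Sum.inl)) +
          star (x ∘ Sum.inr) ⬝ᵥ (D *ᵥ (x ∘ Sum.inr)) := by
      rw [fromBlocks_mulVec]
      simp [dotProduct, Fintype.sum_sum_type]
    rw [key]
    by_cases h : x ∘ Sum.inl = 0
    · have h2 : x ∘ Sum.inr ≠ 0 := by
        intro h2; apply hx; rw [hx', h, h2]; ext i; cases i <;> rfl
      exact add_pos_of_nonneg_of_pos (hA.posSemidef.dotProduct_mulVec_nonneg _)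
        (hD.dotProduct_mulVec_pos h2)
    · exact add_pos_of_pos_of_nonneg (hA.dotProduct_mulVec_pos h)
        (hD.posSemidef.dotProduct_mulVec_nonneg _)

lemma posDef_congr {R : Type*} [CommRing R] [PartialOrder R] [StarRing R] [DecidableEq b]
    {A : Matrix a a R} (hA : A.PosDef) {T : Matrix a b R} {T' : Matrix b a R} (h : T' * T = 1) :
    (Tᴴ * A * T).PosDef :=
  hA.conjTranspose_mul_mul_same fun x y hxy => by
    simpa [mulVec_mulVec, h] using congrArg (T' *ᵥ ·) hxy

variable [DecidableEq a] [DecidableEq b]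

lemma posDef_fromBlocks_schur {A : Matrix a a 𝕜} {B : Matrix a b 𝕜} {D : Matrix b b 𝕜}
    (hA : A.PosDef) (hD : (D - Bᴴ * A⁻¹ * B).PosDef) : (fromBlocks A B Bᴴ D).PosDef := by
  have hu : IsUnit A.det := (isUnit_iff_isUnit_det A).1 hA.isUnit
  have := posDef_congr (posDef_fromBlocks_diag hA hD)
    (T := fromBlocks 1 (A⁻¹ * B) 0 1) (T' := fromBlocks 1 (-(A⁻¹ * B)) 0 1)
    (by simp [fromBlocks_multiply])
  convert! this using 1
  rw [fromBlocks_conjTranspose, fromBlocks_multiply, fromBlocks_multiply]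
  simp [conjTranspose_mul, conjTranspose_nonsing_inv, hA.isHermitian.eq, Matrix.mul_assoc,
    nonsing_inv_mul _ hu, mul_nonsing_inv_cancel_left _ _ hu]

lemma exists_posDef_smul_one_sub {M : Matrix b b 𝕜} (hM : M.IsHermitian) :
    ∃ g : ℝ, 0 < g ∧ ((g : 𝕜) • (1 : Matrix b b 𝕜) - M).PosDef := by
  obtain ⟨g, hg⟩ : ∃ g : ℝ, ∀ i, hM.eigenvalues i < g := by
    obtain ⟨g, hg⟩ := (Set.finite_range hM.eigenvalues).bddAbove
    exact ⟨g + 1, fun i => (hg ⟨i, rfl⟩).trans_lt (lt_add_one g)⟩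
  -- The bound on the eigenvalues may be negative, so it is replaced by its maximum with `1`.
  refine ⟨max g 1, by positivity, ?_⟩
  set U : Matrix b b 𝕜 := (hM.eigenvectorUnitary : Matrix b b 𝕜)
  have hU : U * Uᴴ = 1 := Unitary.mul_star_self_of_mem hM.eigenvectorUnitary.2
  have hd : (diagonal fun i => ((max g 1 : ℝ) : 𝕜) - (hM.eigenvalues i : 𝕜)).PosDef := by
    refine PosDef.diagonal fun i => ?_
    rw [← RCLike.ofReal_sub, RCLike.ofReal_pos]
    exact sub_pos.2 ((hg i).trans_le (le_max_left _ _))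
  have := posDef_congr hd (T := Uᴴ) (T' := U) hU
  convert! this using 1
  conv_lhs => rw [hM.spectral_theorem]
  rw [show (diagonal fun i => ((max g 1 : ℝ) : 𝕜) - (hM.eigenvalues i : 𝕜)) =
    ((max g 1 : ℝ) : 𝕜) • 1 - diagonal (RCLike.ofReal ∘ hM.eigenvalues) by
      rw [smul_one_eq_diagonal, diagonal_sub]; rfl]
  rw [conjTranspose_conjTranspose, Matrix.mul_sub, Matrix.sub_mul]
  simp [hU, Unitary.conjStarAlgAut_apply]
  rfl

lemma exists_posDef_fromBlocks {A : Matrix a a 𝕜} (hA : A.PosDef) (B : Matrix a b 𝕜) :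
    ∃ g : ℝ, 0 < g ∧ (fromBlocks A B Bᴴ ((g : 𝕜) • 1)).PosDef := by
  obtain ⟨g, hg, h⟩ := exists_posDef_smul_one_sub (M := Bᴴ * A⁻¹ * B)
    (isHermitian_conjTranspose_mul_mul B hA.isHermitian.inv)
  exact ⟨g, hg, posDef_fromBlocks_schur hA h⟩

lemma exists_posDef_fromBlocks_complex {A : Matrix a a ℂ} (hA : A.PosDef) (B : Matrix a b ℂ) :
    ∃ g : ℝ, 0 < g ∧ (fromBlocks A B Bᴴ ((g : ℂ) • (1 : Matrix b b ℂ))).PosDef :=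
  exists_posDef_fromBlocks hA B

lemma exists_posDef_fromBlocks_real {A : Matrix a a ℝ} (hA : A.PosDef) (B : Matrix a b ℝ) :
    ∃ g : ℝ, 0 < g ∧ (fromBlocks A B Bᵀ (g • (1 : Matrix b b ℝ))).PosDef :=
  exists_posDef_fromBlocks hA B

end Blocks

/-! ### The sector as two half planes, and the associated Lyapunov inequality. -/

/-- The two real parts are `‖z‖ sin (θ ∓ arg z)`. When `|arg z| ≤ θ`, both angles lie in `[0, 2θ] ⊆
[0, π]`, which is where `θ ≤ π/2` enters. -/
lemma lt_abs_arg_iff {θ : ℝ} (h0 : 0 < θ) (h1 : θ ≤ Real.pi / 2) (z : ℂ) :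
    θ < |Complex.arg z| ↔ ((⟨Real.sin θ, Real.cos θ⟩ : ℂ) * z).re < 0 ∨
      (star (⟨Real.sin θ, Real.cos θ⟩ : ℂ) * z).re < 0 := by
  rcases eq_or_ne z 0 with rfl | hz
  · simp [h0.le]
  have hρ : 0 < ‖z‖ := norm_pos_iff.2 hz
  have e1 : ((⟨Real.sin θ, Real.cos θ⟩ : ℂ) * z).re = ‖z‖ * Real.sin (θ - z.arg) := by
    rw [Real.sin_sub, mul_sub, Complex.mul_re]
    nth_rw 1 [← Complex.norm_mul_cos_arg z]
    nth_rw 1 [← Complex.norm_mul_sin_arg z]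
    ring
  have e2 : (star (⟨Real.sin θ, Real.cos θ⟩ : ℂ) * z).re = ‖z‖ * Real.sin (θ + z.arg) := by
    rw [Real.sin_add, mul_add, Complex.mul_re]
    have : (star (⟨Real.sin θ, Real.cos θ⟩ : ℂ)) = ⟨Real.sin θ, -Real.cos θ⟩ := rfl
    rw [this]
    dsimp only
    nth_rw 1 [← Complex.norm_mul_cos_arg z]
    nth_rw 1 [← Complex.norm_mul_sin_arg z]
    ring
  have hp := Real.pi_pos
  have ha := Complex.neg_pi_lt_arg z
  have hb := Complex.arg_le_pi z
  rw [e1, e2, lt_abs]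
  constructor
  · rintro (h | h)
    · exact Or.inl (mul_neg_of_pos_of_neg hρ
        (Real.sin_neg_of_neg_of_neg_pi_lt (by linarith) (by linarith)))
    · exact Or.inr (mul_neg_of_pos_of_neg hρ
        (Real.sin_neg_of_neg_of_neg_pi_lt (by linarith) (by linarith)))
  · intro h
    by_contra! hcon
    rcases h with h | h
    · exact absurd h (not_lt.2 (mul_nonneg hρ.le
        (Real.sin_nonneg_of_nonneg_of_le_pi (by linarith) (by linarith))))
    · exact absurd h (not_lt.2 (mul_nonneg hρ.le
        (Real.sin_nonneg_of_nonneg_of_le_pi (by linarith) (by linarith))))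

/-- The Lyapunov inequality for the union of the half planes `Re (c z) < 0` and
`Re (c̄ z) < 0`. -/
def TwoHalfPlaneLyapunov {ι : Type*} [Fintype ι] (c : ℂ) (A : Matrix ι ι ℂ) : Prop :=
  ∃ X₁ X₂ : Matrix ι ι ℂ, X₁.PosDef ∧ X₂.PosDef ∧
    (-((c • X₁ + star c • X₂) * A + ((c • X₁ + star c • X₂) * A)ᴴ)).PosDef

lemma TwoHalfPlaneLyapunov.of_similar {ι κ : Type*} [Fintype ι] [Fintype κ] [DecidableEq ι]
    [DecidableEq κ] {c : ℂ} {A : Matrix ι ι ℂ} {T : Matrix ι κ ℂ} {T' : Matrix κ ι ℂ}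
    (h : T * T' = 1) (H : TwoHalfPlaneLyapunov c (T' * A * T)) :
    TwoHalfPlaneLyapunov c A := by
  obtain ⟨X₁, X₂, h₁, h₂, hX⟩ := H
  refine ⟨T'ᴴ * X₁ * T', T'ᴴ * X₂ * T', posDef_congr h₁ h, posDef_congr h₂ h, ?_⟩
  have := posDef_congr hX h
  convert! this using 1
  have e : (c • (T'ᴴ * X₁ * T') + star c • (T'ᴴ * X₂ * T')) * A =
      T'ᴴ * ((c • X₁ + star c • X₂) * (T' * A * T)) * T' := by
    have : T'ᴴ * ((c • X₁ + star c • X₂) * (T' * A * T)) * T' =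
      T'ᴴ * (c • X₁ + star c • X₂) * T' * A * (T * T') := by simp only [Matrix.mul_assoc]
    rw [this, h, Matrix.mul_one]
    simp [Matrix.mul_add, Matrix.add_mul]
  rw [e]
  generalize (c • X₁ + star c • X₂) * (T' * A * T) = N
  simp only [conjTranspose_mul, conjTranspose_conjTranspose, Matrix.mul_neg, Matrix.neg_mul,
    Matrix.mul_add, Matrix.add_mul, Matrix.mul_assoc]

lemma exists_sector_weight {c z : ℂ} (h : (c * z).re < 0 ∨ (star c * z).re < 0) :
    ∃ s t : ℝ, 0 < s ∧ 0 < t ∧ ((c * s + star c * t) * z).re < 0 := by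
  have e : ∀ s t : ℝ, ((c * s + star c * t) * z).re = s * (c * z).re + t * (star c * z).re := by
    intro s t
    simp [Complex.mul_re, Complex.mul_im]
    ring
  simp only [e]
  generalize (c * z).re = x at *
  generalize (star c * z).re = y at *
  rcases h with h | h
  · refine ⟨(|y| + 1) / -x, 1, div_pos (by positivity) (by linarith), one_pos, ?_⟩
    rw [div_neg, neg_mul, div_mul_cancel₀ _ h.ne]
    linarith [le_abs_self y]
  · refine ⟨1, (|x| + 1) / -y, one_pos, div_pos (by positivity) (by linarith), ?_⟩
    rw [div_neg, neg_mul, div_mul_cancel₀ _ h.ne]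
    linarith [le_abs_self x]

/-- Inductive step: both weights are extended by small diagonal entries `τ s`, `τ t`. The new
off-diagonal terms are then of order `τ`, so their contribution to the Schur complement is of order
`τ²`, while the new corner is a positive multiple of `τ`. -/
lemma TwoHalfPlaneLyapunov.fromBlocks {κ : Type*} [Fintype κ] [DecidableEq κ] {c z : ℂ}
    {A : Matrix κ κ ℂ} (w : Matrix Unit κ ℂ) (h : (c * z).re < 0 ∨ (star c * z).re < 0)
    (H : TwoHalfPlaneLyapunov c A) :
    TwoHalfPlaneLyapunov c (fromBlocks A 0 w (z • (1 : Matrix Unit Unit ℂ))) := by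
  obtain ⟨X₁, X₂, h₁, h₂, hX⟩ := H
  obtain ⟨s, t, hs, ht, hst⟩ := exists_sector_weight h
  set p : ℂ := c * s + star c * t with hp
  obtain ⟨g, hg, hG⟩ := exists_posDef_fromBlocks_complex hX (-(p • w)ᴴ)
  set q : ℝ := -(2 * (p * z).re) with hq
  have hq0 : 0 < q := by simp only [hq]; linarith
  -- A congruence by `diag(I, τ)` turns the corner `g` into `τ² g`, which must equal `τ q`.
  have hτ : 0 < q / g := div_pos hq0 hg
  set τ : ℝ := q / g with hτd
  have hone : ∀ x : ℝ, 0 < x → ((x : ℂ) • (1 : Matrix Unit Unit ℂ)).PosDef := fun x hx =>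
    PosDef.one.smul (by exact_mod_cast hx)
  refine ⟨Matrix.fromBlocks X₁ 0 0 (((τ * s : ℝ) : ℂ) • 1),
    Matrix.fromBlocks X₂ 0 0 (((τ * t : ℝ) : ℂ) • 1),
    posDef_fromBlocks_diag h₁ (hone _ (by positivity)),
    posDef_fromBlocks_diag h₂ (hone _ (by positivity)), ?_⟩
  have hτ0 : (τ : ℂ) ≠ 0 := by exact_mod_cast hτ.ne'
  have hT : (Matrix.fromBlocks 1 0 0 ((τ : ℂ)⁻¹ • 1) : Matrix (κ ⊕ Unit) (κ ⊕ Unit) ℂ) *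
      Matrix.fromBlocks 1 0 0 ((τ : ℂ) • 1) = 1 := by
    rw [fromBlocks_multiply]
    simp [-Complex.coe_smul, smul_smul, hτ0]
  have := posDef_congr hG hT
  convert! this using 1
  have hgq : (g : ℂ) * τ = q := by
    rw [hτd]; push_cast; field_simp
  have hqz : -(p * z + star (p * z)) = (q : ℂ) := by
    rw [hq]
    apply Complex.ext <;> simp <;> ring
  simp only [fromBlocks_smul, fromBlocks_add, fromBlocks_multiply, fromBlocks_conjTranspose,
    fromBlocks_neg, smul_zero, add_zero, zero_add, Matrix.mul_zero, Matrix.zero_mul,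
    conjTranspose_zero, conjTranspose_one, Matrix.one_mul, Matrix.mul_one, conjTranspose_smul]
  have e3 : c • ((τ * s : ℝ) : ℂ) • (1 : Matrix Unit Unit ℂ) +
      star c • ((τ * t : ℝ) : ℂ) • (1 : Matrix Unit Unit ℂ) = ((τ : ℂ) * p) • 1 := by
    rw [smul_smul, smul_smul, ← add_smul, hp]
    congr 1
    push_cast
    ring
  rw [e3]
  congr 1
  · simp [-Complex.coe_smul, smul_smul]
  · simp [-Complex.coe_smul, smul_smul, mul_comm p]
  · simp only [Matrix.mul_smul, Matrix.mul_one, conjTranspose_smul,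
      conjTranspose_one, smul_smul, ← add_smul, ← neg_smul]
    congr 1
    rw [show z * (↑τ * p) = τ * (p * z) by ring, show star (τ * (p * z)) = τ * star (p * z) by simp,
      ← mul_add, ← mul_neg, hqz]
    simp [← hgq]

end SingularFOS

/-! ### The complex two-half-plane Lyapunov theorem. -/

namespace SingularFOS

open scoped ComplexOrder

lemma charpoly_conj {R ι κ : Type*} [CommRing R] [Fintype ι] [Fintype κ] [DecidableEq ι]
    [DecidableEq κ] {T : Matrix ι κ R} {T' : Matrix κ ι R} (h : T * T' = 1) (h' : T' * T = 1)
    (A : Matrix ι ι R) : (T' * A * T).charpoly = A.charpoly := by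
  unfold charpoly charmatrix
  have e : (scalar κ) (Polynomial.X : Polynomial R) - Polynomial.C.mapMatrix (T' * A * T) =
      T'.map Polynomial.C * ((scalar ι) Polynomial.X - Polynomial.C.mapMatrix A) *
        T.map Polynomial.C := by
    rw [Matrix.mul_sub, Matrix.sub_mul]
    simp only [scalar_apply, ← smul_one_eq_diagonal, Matrix.mul_smul, Matrix.smul_mul,
      Matrix.mul_one, RingHom.mapMatrix_apply, ← Matrix.map_mul, h']
    simp
  rw [e]
  refine det_conj_of_mul_eq_one ?_ ?_ <;> rw [← Matrix.map_mul] <;> simp [h, h']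

/-- Since `v i ≠ 0`, the vector `v` can replace the `i`-th standard basis vector. In the new basis
the last column of the matrix is `z` times the last basis vector. -/
lemma exists_similar_fromBlocks {ι : Type*} [Fintype ι] [DecidableEq ι] {A : Matrix ι ι ℂ}
    {v : ι → ℂ} {z : ℂ} {i : ι} (hi : v i ≠ 0) (hv : A *ᵥ v = z • v) :
    ∃ (T : Matrix ι ({j // j ≠ i} ⊕ Unit) ℂ) (T' : Matrix ({j // j ≠ i} ⊕ Unit) ι ℂ)
      (A' : Matrix {j // j ≠ i} {j // j ≠ i} ℂ) (w : Matrix Unit {j // j ≠ i} ℂ),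
      T * T' = 1 ∧ T' * T = 1 ∧ T' * A * T = fromBlocks A' 0 w (z • (1 : Matrix Unit Unit ℂ)) := by
  let T : Matrix ι ({j // j ≠ i} ⊕ Unit) ℂ :=
    .of fun j => Sum.elim (fun k => if j = k then 1 else 0) fun _ => v j
  let T' : Matrix ({j // j ≠ i} ⊕ Unit) ι ℂ :=
    .of (Sum.elim (fun k j => (if j = k then 1 else 0) - if j = i then v k / v i else 0)
      fun _ j => if j = i then (v i)⁻¹ else 0)
  have h' : T' * T = 1 := by
    ext (k | _) (l | _)
    · simp [T, T', mul_apply, one_apply, l.2.symm, Subtype.ext_iff, eq_comm]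
    · simp [T, T', mul_apply, sub_mul, Finset.sum_sub_distrib, hi]
    · simpa [T, T', mul_apply] using fun h => absurd h l.2
    · simp [T, T', mul_apply, hi]
  have e : ι ≃ {j // j ≠ i} ⊕ Unit :=
    ((Equiv.sumCompl (· ≠ i)).symm.trans (Equiv.sumCongr (Equiv.refl _)
      ((Equiv.subtypeEquivRight (by simp)).trans (Equiv.ofUnique {j // j = i} Unit))))
  have h : T * T' = 1 := (mul_eq_one_comm_of_equiv e).2 h'
  -- Multiplying by `J` on the right keeps only the column of the eigenvector.
  let J : Matrix ({j // j ≠ i} ⊕ Unit) ({j // j ≠ i} ⊕ Unit) ℂ := fromBlocks 0 0 0 1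
  have hcol : T' * A * T * J =
      fromBlocks 0 0 0 (z • (1 : Matrix Unit Unit ℂ)) := by
    have h1 : A * T * J =
        z • (T * J) := by
      ext j (k | _)
      · simp [J, mul_apply]
      · have := congrFun hv j
        simpa [J, T, mul_apply, mulVec, dotProduct] using this
    rw [Matrix.mul_assoc, Matrix.mul_assoc, ← Matrix.mul_assoc A, h1, Matrix.mul_smul,
      ← Matrix.mul_assoc, h', Matrix.one_mul, fromBlocks_smul]
    simp
  refine ⟨T, T', (T' * A * T).toBlocks₁₁, (T' * A * T).toBlocks₂₁, h, h', ?_⟩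
  rw [← fromBlocks_toBlocks (T' * A * T), fromBlocks_multiply] at hcol
  simp only [Matrix.mul_zero, Matrix.mul_one, zero_add, fromBlocks_inj] at hcol
  conv_lhs => rw [← fromBlocks_toBlocks (T' * A * T)]
  rw [hcol.2.1, hcol.2.2.2]

lemma twoHalfPlaneLyapunov_of_charpoly (c : ℂ) {ι : Type*} [Fintype ι] [DecidableEq ι]
    (A : Matrix ι ι ℂ)
    (hA : ∀ z, A.charpoly.IsRoot z → (c * z).re < 0 ∨ (star c * z).re < 0) :
    TwoHalfPlaneLyapunov c A := by
  induction h : Fintype.card ι generalizing ι with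
  | zero =>
    have : IsEmpty ι := Fintype.card_eq_zero_iff.1 h
    refine ⟨1, 1, PosDef.one, PosDef.one, ?_⟩
    convert! (PosDef.one : (1 : Matrix ι ι ℂ).PosDef)
    exact Subsingleton.elim _ _
  | succ n ih =>
    have : Nonempty ι := Fintype.card_pos_iff.1 (by omega)
    obtain ⟨z, hz⟩ := IsAlgClosed.exists_root A.charpoly (by
      rw [charpoly_degree_eq_dim, h]; exact_mod_cast n.succ_ne_zero)
    have hdet : (scalar ι z - A).det = 0 := by rw [← eval_charpoly]; exact hz
    obtain ⟨v, hv0, hv⟩ := exists_mulVec_eq_zero_iff.2 hdet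
    have hv : A *ᵥ v = z • v := by
      rw [sub_mulVec, sub_eq_zero] at hv
      rw [← hv, scalar_apply, ← smul_one_eq_diagonal, smul_mulVec, one_mulVec]
    obtain ⟨i, hi⟩ := Function.ne_iff.1 hv0
    obtain ⟨T, T', A', w, h1, h2, h3⟩ := exists_similar_fromBlocks hi hv
    have hc := charpoly_conj h1 h2 A
    rw [h3, charpoly_fromBlocks_zero₁₂] at hc
    refine .of_similar h1 ?_
    rw [h3]
    refine .fromBlocks w (hA z hz) (ih A' (fun x hx => hA x ?_) ?_)
    · rw [← hc]
      exact Polynomial.root_mul_right_of_isRoot _ hx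
    · rw [Fintype.card_subtype_compl, h]; simp

end SingularFOS

/-! ### Real matrices versus Hermitian ones, and the fractional class. -/

namespace SingularFOS

open scoped ComplexOrder

lemma map_ofReal_mul {l m k : Type*} [Fintype m] (M : Matrix l m ℝ) (N : Matrix m k ℝ) :
    (M * N).map Complex.ofReal = M.map Complex.ofReal * N.map Complex.ofReal :=
  Matrix.map_mul (f := Complex.ofRealHom)

section Complexification

variable {ι : Type*} [Fintype ι]

lemma re_star_dotProduct_mulVec (X Y : Matrix ι ι ℝ) (x y : ι → ℝ) :
    (star (fun i => (⟨x i, y i⟩ : ℂ)) ⬝ᵥ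
      ((of fun i j => (⟨X i j, -Y i j⟩ : ℂ)) *ᵥ fun i => (⟨x i, y i⟩ : ℂ))).re =
    star (Sum.elim x y) ⬝ᵥ (fromBlocks X Y (-Y) X *ᵥ Sum.elim x y) := by
  simp only [dotProduct, mulVec, Fintype.sum_sum_type, Complex.re_sum, Finset.mul_sum,
    ← Finset.sum_add_distrib, of_apply, Pi.star_apply, fromBlocks_apply₁₁, fromBlocks_apply₁₂,
    fromBlocks_apply₂₁, fromBlocks_apply₂₂, Sum.elim_inl, Sum.elim_inr, star_trivial, Matrix.neg_apply]
  refine Finset.sum_congr rfl fun i _ => Finset.sum_congr rfl fun j _ => ?_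
  simp only [Complex.mul_re, Complex.mul_im, Complex.star_def, Complex.conj_re, Complex.conj_im]
  ring

/-- The block matrix is the realification of `X - iY`: the two quadratic forms agree under `(x, y) ↦
x + iy`. -/
lemma posDef_fromBlocks_iff_complex (X Y : Matrix ι ι ℝ) :
    (fromBlocks X Y (-Y) X).PosDef ↔ (of fun i j => (⟨X i j, -Y i j⟩ : ℂ)).PosDef := by
  have hH : (fromBlocks X Y (-Y) X).IsHermitian ↔
      (of fun i j => (⟨X i j, -Y i j⟩ : ℂ)).IsHermitian := by
    rw [isHermitian_fromBlocks_iff]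
    simp only [IsHermitian, ← Matrix.ext_iff, conjTranspose_apply, of_apply, Complex.ext_iff,
      Complex.star_def, Complex.conj_re, Complex.conj_im, star_trivial, Matrix.neg_apply]
    constructor
    · exact fun h i j => ⟨h.1 i j, by have := h.2.1 i j; linarith⟩
    · exact fun h => ⟨fun i j => (h i j).1, fun i j => by have := (h i j).2; linarith,
        fun i j => by have := (h i j).2; linarith, fun i j => (h i j).1⟩
  rw [posDef_iff_dotProduct_mulVec, posDef_iff_dotProduct_mulVec, hH]
  refine and_congr_right fun hZ => ⟨fun h v hv => ?_, fun h x hx => ?_⟩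
  · rw [Complex.pos_iff]
    refine ⟨?_, (hZ.im_star_dotProduct_mulVec_self v).symm⟩
    have := re_star_dotProduct_mulVec X Y (fun i => (v i).re) (fun i => (v i).im)
    simp only [Complex.eta] at this
    rw [this]
    refine h fun h0 => hv (funext fun i => ?_)
    have h1 := congrFun h0 (Sum.inl i)
    have h2 := congrFun h0 (Sum.inr i)
    exact Complex.ext h1 h2
  · have e := re_star_dotProduct_mulVec X Y (x ∘ Sum.inl) (x ∘ Sum.inr)
    rw [Sum.elim_comp_inl_inr] at e
    rw [← e]
    refine (Complex.pos_iff.1 (h fun h0 => hx (funext ?_))).1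
    rintro (i | i)
    · exact congrArg Complex.re (congrFun h0 i)
    · exact congrArg Complex.im (congrFun h0 i)

lemma posDef_map_ofReal_iff {X : Matrix ι ι ℝ} : (X.map Complex.ofReal).PosDef ↔ X.PosDef := by
  have e : X.map Complex.ofReal = of fun i j => (⟨X i j, -(0 : Matrix ι ι ℝ) i j⟩ : ℂ) := by
    ext i j; simp [Complex.ext_iff]
  rw [e, ← posDef_fromBlocks_iff_complex]
  constructor
  · intro h
    exact h.submatrix (e := Sum.inl) Sum.inl_injective
  · intro h
    rw [neg_zero]
    exact posDef_fromBlocks_diag h h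

end Complexification

/-- `P` is the real matrix `c • Z + c̄ • Zᵀ` for a Hermitian positive definite `Z`. -/
def TwoRayPosDef {ι : Type*} (c : ℂ) (P : Matrix ι ι ℝ) : Prop :=
  ∃ Z : Matrix ι ι ℂ, Z.PosDef ∧ P.map Complex.ofReal = c • Z + star c • Zᵀ

/-- Take `Z = (X - iY) / 2`. As `Zᵀ` is the entrywise conjugate of `Z`, the sum `c Z + c̄ Zᵀ` equals
`2 Re (c Z)`. -/
lemma mem_fracPosDef_iff {n : ℕ} {α : ℝ} {P : Matrix (Fin n) (Fin n) ℝ} :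
    P ∈ fracPosDef n α ↔
      TwoRayPosDef ⟨Real.sin (α * Real.pi / 2), Real.cos (α * Real.pi / 2)⟩ P := by
  simp only [fracPosDef, TwoRayPosDef, Set.mem_ofPred_eq]
  generalize Real.sin (α * Real.pi / 2) = s
  generalize Real.cos (α * Real.pi / 2) = c
  constructor
  · rintro ⟨X, Y, h, rfl⟩
    have hZ := (posDef_fromBlocks_iff_complex X Y).1 h
    refine ⟨(2⁻¹ : ℂ) • of fun i j => (⟨X i j, -Y i j⟩ : ℂ), hZ.smul (by norm_num), ?_⟩
    ext i j
    have hH := hZ.isHermitian.apply i j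
    rw [of_apply, of_apply, Complex.ext_iff] at hH
    simp only [Complex.star_def, Complex.conj_re, Complex.conj_im, neg_neg] at hH
    apply Complex.ext
    · simp [hH.1, hH.2]
      linarith
    · simp [hH.1, hH.2]
      ring
  · rintro ⟨Z, hZ, h⟩
    refine ⟨of fun i j => 2 * (Z i j).re, of fun i j => -(2 * (Z i j).im), ?_, ?_⟩
    · rw [posDef_fromBlocks_iff_complex]
      have : (of fun i j => (⟨2 * (Z i j).re, - -(2 * (Z i j).im)⟩ : ℂ)) = (2 : ℂ) • Z := by
        ext i j; simp [Complex.ext_iff]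
      exact this ▸ hZ.smul (by norm_num : (0 : ℂ) < 2)
    · ext i j
      have hH := hZ.isHermitian.apply i j
      have := congrArg Complex.re (congrFun (congrFun h i) j)
      rw [map_apply, Complex.ofReal_re] at this
      rw [this]
      rw [Complex.ext_iff] at hH
      simp only [Complex.star_def, Complex.conj_re, Complex.conj_im] at hH
      simp [hH.1, ← hH.2]
      ring

section TwoRay

variable {ι κ : Type*} {c : ℂ}

lemma TwoRayPosDef.transpose {P : Matrix ι ι ℝ} (h : TwoRayPosDef c P) : TwoRayPosDef c Pᵀ := by
  obtain ⟨Z, hZ, e⟩ := h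
  refine ⟨Zᵀ, hZ.transpose, ?_⟩
  rw [transpose_map, e]
  simp

lemma TwoRayPosDef.congr [Fintype ι] [Fintype κ] [DecidableEq κ] {P : Matrix ι ι ℝ}
    (h : TwoRayPosDef c P) {T : Matrix ι κ ℝ} {T' : Matrix κ ι ℝ} (hT : T' * T = 1) :
    TwoRayPosDef c (Tᵀ * P * T) := by
  obtain ⟨Z, hZ, e⟩ := h
  have hTc : T'.map Complex.ofReal * T.map Complex.ofReal = 1 := by
    rw [← map_ofReal_mul, hT]; simp
  have hTH : (T.map Complex.ofReal)ᴴ = Tᵀ.map Complex.ofReal := by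
    ext i j; simp
  refine ⟨_, posDef_congr hZ hTc, ?_⟩
  rw [map_ofReal_mul, map_ofReal_mul, e, hTH]
  simp [Matrix.mul_add, Matrix.add_mul, Matrix.mul_assoc, transpose_map]

lemma TwoRayPosDef.fromBlocks_diag [Fintype ι] [Fintype κ] {P : Matrix ι ι ℝ} {Q : Matrix κ κ ℝ}
    (hP : TwoRayPosDef c P) (hQ : TwoRayPosDef c Q) : TwoRayPosDef c (fromBlocks P 0 0 Q) := by
  obtain ⟨Z, hZ, e⟩ := hP
  obtain ⟨W, hW, f⟩ := hQ
  refine ⟨_, posDef_fromBlocks_diag hZ hW, ?_⟩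
  rw [fromBlocks_map, e, f, fromBlocks_transpose, fromBlocks_smul, fromBlocks_smul,
    fromBlocks_add]
  simp

lemma twoRayPosDef_smul_one [Fintype ι] [DecidableEq ι] :
    TwoRayPosDef c ((2 * c.re) • (1 : Matrix ι ι ℝ)) := by
  refine ⟨1, PosDef.one, ?_⟩
  rw [transpose_one, ← add_smul]
  ext i j
  by_cases h : i = j
  · subst h
    simp [Complex.ext_iff, two_mul]
  · simp [h]

lemma exists_twoRayPosDef_lyapunov [Fintype ι] [DecidableEq ι] (A : Matrix ι ι ℝ)
    (hA : ∀ z, (A.map Complex.ofReal).charpoly.IsRoot z →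
      (c * z).re < 0 ∨ (star c * z).re < 0) :
    ∃ P : Matrix ι ι ℝ, TwoRayPosDef c P ∧ (-((P * A)ᵀ + P * A)).PosDef := by
  obtain ⟨X₁, X₂, h₁, h₂, hL⟩ := twoHalfPlaneLyapunov_of_charpoly c (A.map Complex.ofReal) hA
  set N := c • X₁ + star c • X₂ with hN
  -- Adding to the complex solution its entrywise conjugate `Nᴴᵀ` keeps the inequality, because `A`
  -- is real, and gives a real matrix with `Z = X₁ + X₂ᵀ`.
  let P : Matrix ι ι ℝ := of fun i j => 2 * (N i j).re
  have hP : P.map Complex.ofReal = N + Nᴴᵀ := by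
    ext i j
    simp [P, Complex.ext_iff, two_mul]
  refine ⟨P, ⟨X₁ + X₂ᵀ, h₁.add h₂.transpose, ?_⟩, ?_⟩
  · rw [hP, hN]
    simp only [conjTranspose_add, conjTranspose_smul, h₁.isHermitian.eq, h₂.isHermitian.eq,
      transpose_add, transpose_smul, smul_add, transpose_transpose, star_star]
    abel
  · rw [← posDef_map_ofReal_iff]
    convert! hL.add hL.transpose using 1
    have hA' : A.map Complex.ofReal = (A.map Complex.ofReal)ᴴᵀ := by
      ext i j; simp
    have e : (P * A).map Complex.ofReal = N * A.map Complex.ofReal +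
        (N * A.map Complex.ofReal)ᴴᵀ := by
      rw [map_ofReal_mul, hP, Matrix.add_mul, conjTranspose_mul, transpose_mul, ← hA']
    have e2 : (-((P * A)ᵀ + P * A)).map Complex.ofReal =
        -(((P * A).map Complex.ofReal)ᵀ + (P * A).map Complex.ofReal) := by
      ext i j; simp [-transpose_mul]
    rw [e2, e]
    simp only [transpose_neg, transpose_add, transpose_transpose]
    abel

end TwoRay

end SingularFOS

/-! ### Matrix pencils: rank normal form and decoupled form. -/

namespace SingularFOS

open Polynomial Filter Topology

/-- `U` and `U'` are mutually inverse matrices, indexed by possibly different types. -/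
structure IsInversePair {ι κ : Type*} [Fintype ι] [Fintype κ] [DecidableEq ι] [DecidableEq κ]
    (U : Matrix ι κ ℝ) (U' : Matrix κ ι ℝ) : Prop where
  mul_inv : U * U' = 1
  inv_mul : U' * U = 1

lemma IsInversePair.mul {ι κ μ : Type*} [Fintype ι] [Fintype κ] [Fintype μ] [DecidableEq ι]
    [DecidableEq κ] [DecidableEq μ] {U : Matrix ι κ ℝ} {U' : Matrix κ ι ℝ} {V : Matrix κ μ ℝ}
    {V' : Matrix μ κ ℝ} (hU : IsInversePair U U') (hV : IsInversePair V V') :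
    IsInversePair (U * V) (V' * U') where
  mul_inv := by
    rw [Matrix.mul_assoc, ← Matrix.mul_assoc V, hV.mul_inv, Matrix.one_mul, hU.mul_inv]
  inv_mul := by
    rw [Matrix.mul_assoc, ← Matrix.mul_assoc U', hU.inv_mul, Matrix.one_mul, hV.inv_mul]

lemma isInversePair_nonsing_inv {κ : Type*} [Fintype κ] [DecidableEq κ] {L : Matrix κ κ ℝ}
    (h : IsUnit L.det) : IsInversePair L L⁻¹ :=
  ⟨mul_nonsing_inv _ h, nonsing_inv_mul _ h⟩

lemma IsInversePair.submatrix {ι κ : Type*} [Fintype ι] [Fintype κ] [DecidableEq ι]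
    [DecidableEq κ] {L L' : Matrix ι ι ℝ} (h : IsInversePair L L') (e : κ ≃ ι) :
    IsInversePair (L.submatrix id e) (L'.submatrix e id) := by
  constructor
  · rw [submatrix_mul_equiv, h.mul_inv, submatrix_id_id]
  · have := submatrix_mul_equiv L' L e (Equiv.refl ι) e
    simp only [Equiv.coe_refl] at this
    rw [this, h.inv_mul, submatrix_one_equiv]

lemma IsInversePair.symm {ι κ : Type*} [Fintype ι] [Fintype κ] [DecidableEq ι]
    [DecidableEq κ] {U : Matrix ι κ ℝ} {U' : Matrix κ ι ℝ} (h : IsInversePair U U') :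
    IsInversePair U' U := ⟨h.inv_mul, h.mul_inv⟩

lemma exists_rank_normal_form {ι : Type} [Fintype ι] [DecidableEq ι] (E : Matrix ι ι ℝ) :
    ∃ (a b : Type) (_ : Fintype a) (_ : Fintype b) (_ : DecidableEq a) (_ : DecidableEq b)
      (U : Matrix ι (a ⊕ b) ℝ) (U' : Matrix (a ⊕ b) ι ℝ) (V : Matrix (a ⊕ b) ι ℝ)
      (V' : Matrix ι (a ⊕ b) ℝ), IsInversePair U U' ∧ IsInversePair V V' ∧
      Fintype.card a = E.rank ∧ E = U * (fromBlocks 1 0 0 0 : Matrix (a ⊕ b) (a ⊕ b) ℝ) * V := by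
  classical
  obtain ⟨L, L', d, h⟩ := Pivot.exists_list_transvec_mul_diagonal_mul_list_transvec E
  set M := (L.map TransvectionStruct.toMatrix).prod
  set M' := (L'.map TransvectionStruct.toMatrix).prod
  have hM : IsUnit M.det := by
    rw [TransvectionStruct.det_toMatrix_prod]; exact isUnit_one
  have hM' : IsUnit M'.det := by
    rw [TransvectionStruct.det_toMatrix_prod]; exact isUnit_one
  -- Replacing zeros by `1` makes the diagonal invertible; it is absorbed into the left factor,
  -- leaving a 0-1 diagonal.
  let d' : ι → ℝ := fun i => if d i ≠ 0 then d i else 1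
  have hd' : IsUnit (diagonal d').det := by
    rw [det_diagonal, isUnit_iff_ne_zero, Finset.prod_ne_zero_iff]
    intro i _
    simp only [d']
    split_ifs with h0
    · exact h0
    · exact one_ne_zero
  let e : {i // d i ≠ 0} ⊕ {i // ¬ d i ≠ 0} ≃ ι := Equiv.sumCompl fun i => d i ≠ 0
  have hJ : (fromBlocks 1 0 0 0 :
      Matrix ({i // d i ≠ 0} ⊕ {i // ¬ d i ≠ 0}) ({i // d i ≠ 0} ⊕ {i // ¬ d i ≠ 0}) ℝ) =
      (diagonal fun i => if d i ≠ 0 then (1 : ℝ) else 0).submatrix e e := by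
    ext (i | i) (j | j)
    · simp [e, diagonal_apply, one_apply, i.2, Subtype.ext_iff]
    · have : (i : ι) ≠ j := fun h => j.2 (h ▸ i.2)
      simp [e, this]
    · have : (i : ι) ≠ j := fun h => i.2 (h ▸ j.2)
      simp [e, this]
    · have := not_not.1 i.2
      simp [e, diagonal_apply, this]
  refine ⟨_, _, inferInstance, inferInstance, inferInstance, inferInstance, _, _, _, _,
    ((isInversePair_nonsing_inv hM).mul (isInversePair_nonsing_inv hd')).submatrix e,
    ((isInversePair_nonsing_inv hM').symm.submatrix e).symm, ?_, ?_⟩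
  · rw [h, rank_mul_eq_left_of_isUnit_det _ _ hM', rank_mul_eq_right_of_isUnit_det _ _ hM,
      rank_diagonal]
  · rw [hJ, submatrix_mul_equiv, submatrix_mul_equiv, submatrix_id_id, Matrix.mul_assoc M,
      diagonal_mul_diagonal, h]
    congr 3
    ext i
    by_cases h0 : d i = 0 <;> simp [d', h0]

/-- The polynomial `det (s E - A)` for matrices over an arbitrary finite index type. -/
noncomputable def pencilPoly {ι : Type*} [Fintype ι] [DecidableEq ι] (E A : Matrix ι ι ℝ) : ℝ[X] :=
  ((X : ℝ[X]) • E.map C - A.map C).det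

section Pencil

variable {ι κ a b : Type*} [Fintype ι] [DecidableEq ι] [Fintype κ] [DecidableEq κ]
  [Fintype a] [DecidableEq a] [Fintype b] [DecidableEq b]

lemma exists_pencilPoly_mul_mul {U : Matrix ι κ ℝ} {U' : Matrix κ ι ℝ} {V : Matrix κ ι ℝ}
    {V' : Matrix ι κ ℝ} (hU : IsInversePair U U') (hV : IsInversePair V V')
    (J K : Matrix κ κ ℝ) :
    ∃ d : ℝ, d ≠ 0 ∧ pencilPoly (U * J * V) (U * K * V) = C d * pencilPoly J K := by
  -- `U` and `V` may have different row and column types and so no determinant of their own; the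
  -- square product `V U` does.
  refine ⟨(V * U).det, ?_, ?_⟩
  · exact (isUnit_det_of_left_inverse (hV.mul hU).inv_mul).ne_zero
  · unfold pencilPoly
    have e : (X : ℝ[X]) • (U * J * V).map C - (U * K * V).map C =
        U.map C * (((X : ℝ[X]) • J.map C - K.map C) * (V * U).map C) * U'.map C := by
      have hVU : V.map (C : ℝ →+* ℝ[X]) = (V * U).map C * U'.map C := by
        rw [← Matrix.map_mul, Matrix.mul_assoc, hU.mul_inv, Matrix.mul_one]
      rw [← Matrix.mul_assoc (U.map C), Matrix.mul_assoc _ ((V * U).map C), ← hVU]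
      simp only [Matrix.map_mul, Matrix.sub_mul, Matrix.mul_sub, Matrix.smul_mul,
        Matrix.mul_smul, Matrix.mul_assoc]
    rw [e, det_conj_of_mul_eq_one, det_mul, mul_comm]
    · congr 1
      exact (RingHom.map_det C (V * U)).symm
    · rw [← Matrix.map_mul, hU.mul_inv]; simp
    · rw [← Matrix.map_mul, hU.inv_mul]; simp

lemma pencilPoly_fromBlocks_of_isUnit (A₁ : Matrix a a ℝ) (A₂ : Matrix a b ℝ) (A₃ : Matrix b a ℝ)
    {A₄ : Matrix b b ℝ} (h : IsUnit A₄.det) :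
    pencilPoly (fromBlocks 1 0 0 0) (fromBlocks A₁ A₂ A₃ A₄) =
      C (-A₄).det * (A₁ - A₂ * A₄⁻¹ * A₃).charpoly := by
  have h1 : -(A₄.map (C : ℝ →+* ℝ[X])) * -(A₄⁻¹.map C) = 1 := by
    rw [neg_mul_neg, ← Matrix.map_mul, mul_nonsing_inv _ h]; simp
  let _ : Invertible (-(A₄.map (C : ℝ →+* ℝ[X]))) := invertibleOfRightInverse _ _ h1
  have h2 : ⅟(-(A₄.map (C : ℝ →+* ℝ[X]))) = -(A₄⁻¹.map C) := invOf_eq_right_inv h1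
  unfold pencilPoly
  have e : (X : ℝ[X]) • (fromBlocks 1 0 0 0 : Matrix (a ⊕ b) (a ⊕ b) ℝ).map C -
      (fromBlocks A₁ A₂ A₃ A₄).map C = fromBlocks ((X : ℝ[X]) • 1 - A₁.map C) (-A₂.map C)
        (-A₃.map C) (-A₄.map C) := by
    rw [fromBlocks_map, fromBlocks_map, fromBlocks_smul, sub_eq_add_neg, fromBlocks_neg,
      fromBlocks_add]
    simp [sub_eq_add_neg]
  rw [e, det_fromBlocks₂₂, h2]
  congr 1
  · have := RingHom.map_det C (-A₄)
    rw [this]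
    congr 1
    ext i j; simp
  · unfold Matrix.charpoly charmatrix
    congr 1
    rw [scalar_apply, ← smul_one_eq_diagonal, RingHom.mapMatrix_apply, Matrix.map_sub _ (by simp),
      Matrix.map_mul, Matrix.map_mul]
    simp only [Matrix.neg_mul, Matrix.mul_neg, neg_neg]
    abel

/-- As `s → ∞`, the quotient `p(s) / s ^ card a` tends both to `det (-A₄)` and to the leading
coefficient of `p`, which is nonzero. -/
lemma det_ne_zero_of_degree_pencilPoly {A₁ : Matrix a a ℝ} {A₂ : Matrix a b ℝ}
    {A₃ : Matrix b a ℝ} {A₄ : Matrix b b ℝ}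
    (h : (pencilPoly (fromBlocks 1 0 0 0) (fromBlocks A₁ A₂ A₃ A₄)).degree =
      (Fintype.card a : WithBot ℕ)) : A₄.det ≠ 0 := by
  set p := pencilPoly (fromBlocks 1 0 0 0) (fromBlocks A₁ A₂ A₃ A₄) with hp
  let f : ℝ → ℝ := fun t => (fromBlocks (1 - t • A₁) (-(t • A₂)) (-A₃) (-A₄)).det
  have hf : Continuous f := by
    refine Continuous.matrix_det (Continuous.matrix_fromBlocks ?_ ?_ ?_ ?_) <;> fun_prop
  have hf0 : f 0 = (-A₄).det := by
    simp only [f, zero_smul, sub_zero, neg_zero]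
    rw [det_fromBlocks_zero₁₂, det_one, one_mul]
  have heval : ∀ s : ℝ, s ≠ 0 → p.eval s / (X ^ Fintype.card a : ℝ[X]).eval s = f s⁻¹ := by
    intro s hs
    have e1 : p.eval s = (fromBlocks (s • 1 - A₁) (-A₂) (-A₃) (-A₄)).det := by
      rw [hp, pencilPoly, ← coe_evalRingHom, RingHom.map_det]
      congr 1
      ext (i | i) (j | j) <;> simp [one_apply, apply_ite]
    have e2 : fromBlocks (s • 1 - A₁) (-A₂) (-A₃) (-A₄) =
        fromBlocks (s • 1) 0 0 1 * fromBlocks (1 - s⁻¹ • A₁) (-(s⁻¹ • A₂)) (-A₃) (-A₄) := by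
      rw [fromBlocks_multiply]
      simp [smul_sub, smul_smul, hs]
    rw [e1, e2, det_mul, det_fromBlocks_zero₁₂, det_smul]
    simp [f]
    field_simp
  have l1 : Tendsto (fun s => p.eval s / (X ^ Fintype.card a : ℝ[X]).eval s) atTop
      (𝓝 (p.leadingCoeff / (X ^ Fintype.card a : ℝ[X]).leadingCoeff)) :=
    div_tendsto_atTop_leadingCoeff_div_of_degree_eq _ _ (by rw [h, degree_X_pow])
  have l2 : Tendsto (fun s : ℝ => f s⁻¹) atTop (𝓝 (f 0)) :=
    (hf.tendsto 0).comp tendsto_inv_atTop_zero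
  have l3 := l1.congr' ((eventually_ne_atTop 0).mono heval)
  have := tendsto_nhds_unique l2 l3
  rw [hf0, det_neg, leadingCoeff_X_pow, div_one] at this
  intro h0
  rw [h0, mul_zero] at this
  have hp0 : p = 0 := leadingCoeff_eq_zero.1 this.symm
  rw [hp0, degree_zero] at h
  exact absurd h (by simp)

/-- Block elimination with the invertible block `K₂₂`; both elimination factors together leave
`diag(I, 0)` unchanged. -/
lemma exists_weierstrass_form {U : Matrix ι (a ⊕ b) ℝ} {U' : Matrix (a ⊕ b) ι ℝ}
    {V : Matrix (a ⊕ b) ι ℝ} {V' : Matrix ι (a ⊕ b) ℝ} (hU : IsInversePair U U')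
    (hV : IsInversePair V V') (A : Matrix ι ι ℝ) (h : IsUnit (U' * A * V').toBlocks₂₂.det) :
    ∃ (W : Matrix ι (a ⊕ b) ℝ) (W' : Matrix (a ⊕ b) ι ℝ) (S : Matrix (a ⊕ b) ι ℝ)
      (S' : Matrix ι (a ⊕ b) ℝ) (Ar : Matrix a a ℝ), IsInversePair W W' ∧ IsInversePair S S' ∧
      U * (fromBlocks 1 0 0 0 : Matrix (a ⊕ b) (a ⊕ b) ℝ) * V =
        W * (fromBlocks 1 0 0 0 : Matrix (a ⊕ b) (a ⊕ b) ℝ) * S ∧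
      A = W * (fromBlocks Ar 0 0 1 : Matrix (a ⊕ b) (a ⊕ b) ℝ) * S := by
  set K := U' * A * V' with hK
  have hA : A = U * K * V := by
    have : U * K * V = (U * U') * A * (V' * V) := by simp only [hK, Matrix.mul_assoc]
    rw [this, hU.mul_inv, hV.inv_mul, Matrix.one_mul, Matrix.mul_one]
  have hL : IsUnit (fromBlocks 1 K.toBlocks₁₂ 0 K.toBlocks₂₂ : Matrix (a ⊕ b) (a ⊕ b) ℝ).det := by
    rwa [det_fromBlocks_zero₂₁, det_one, one_mul]
  have hR : IsUnit (fromBlocks 1 0 (K.toBlocks₂₂⁻¹ * K.toBlocks₂₁) 1 :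
      Matrix (a ⊕ b) (a ⊕ b) ℝ).det := by
    rw [det_fromBlocks_zero₁₂, det_one, det_one, one_mul]; exact isUnit_one
  refine ⟨_, _, _, _, K.toBlocks₁₁ - K.toBlocks₁₂ * K.toBlocks₂₂⁻¹ * K.toBlocks₂₁,
    hU.mul (isInversePair_nonsing_inv hL), (isInversePair_nonsing_inv hR).mul hV, ?_, ?_⟩
  · have : (fromBlocks 1 0 0 0 : Matrix (a ⊕ b) (a ⊕ b) ℝ) =
        fromBlocks 1 K.toBlocks₁₂ 0 K.toBlocks₂₂ * fromBlocks 1 0 0 0 *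
          fromBlocks 1 0 (K.toBlocks₂₂⁻¹ * K.toBlocks₂₁) 1 := by
      simp [fromBlocks_multiply]
    conv_lhs => rw [this]
    simp only [Matrix.mul_assoc]
  · have : K = fromBlocks 1 K.toBlocks₁₂ 0 K.toBlocks₂₂ *
        fromBlocks (K.toBlocks₁₁ - K.toBlocks₁₂ * K.toBlocks₂₂⁻¹ * K.toBlocks₂₁) 0 0 1 *
          fromBlocks 1 0 (K.toBlocks₂₂⁻¹ * K.toBlocks₂₁) 1 := by
      conv_lhs => rw [← fromBlocks_toBlocks K]
      simp [fromBlocks_multiply, Matrix.mul_assoc, mul_nonsing_inv_cancel_left _ _ h]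
    conv_lhs => rw [hA, this]
    simp only [Matrix.mul_assoc]

end Pencil

/-- The row space of `E₂` lies in the left kernel of `E` and has the same dimension, so it contains
every row of `M`. -/
lemma exists_eq_mul_of_mul_eq_zero {ι κ : Type*} [Fintype ι] {k : ℕ} {E : Matrix ι ι ℝ}
    {E₂ : Matrix (Fin k) ι ℝ} (hrank : E.rank + E₂.rank = Fintype.card ι) (h : E₂ * E = 0) {M : Matrix κ ι ℝ}
    (hM : M * E = 0) : ∃ Q : Matrix κ (Fin k) ℝ, M = Q * E₂ := by
  have hle : LinearMap.range E₂ᵀ.mulVecLin ≤ LinearMap.ker Eᵀ.mulVecLin := by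
    rintro _ ⟨x, rfl⟩
    rw [LinearMap.mem_ker, mulVecLin_apply, mulVecLin_apply, mulVec_mulVec, ← transpose_mul, h]
    simp
  have heq := Submodule.eq_of_le_of_finrank_eq hle (by
    have h1 := LinearMap.finrank_range_add_finrank_ker Eᵀ.mulVecLin
    have h2 : Module.finrank ℝ (LinearMap.range E₂ᵀ.mulVecLin) = E₂.rank := rank_transpose E₂
    have h3 : Module.finrank ℝ (LinearMap.range Eᵀ.mulVecLin) = E.rank := rank_transpose E
    rw [Module.finrank_fintype_fun_eq_card] at h1
    omega)
  have : ∀ i, ∃ q, E₂ᵀ *ᵥ q = M i := by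
    intro i
    have hi : M i ∈ LinearMap.ker Eᵀ.mulVecLin := by
      rw [LinearMap.mem_ker, mulVecLin_apply, mulVec_transpose]
      exact congrFun hM i
    rw [← heq] at hi
    exact hi
  choose Q hQ using this
  refine ⟨of Q, ?_⟩
  ext i j
  rw [← hQ i, mulVec_transpose]
  rfl

end SingularFOS

/-! ### The Lyapunov criterion for admissibility. -/

namespace SingularFOS

open Polynomial

lemma isUnit_det_of_posDef_add_transpose {ι : Type*} [Fintype ι] [DecidableEq ι]
    {N : Matrix ι ι ℝ} (h : (N + Nᵀ).PosDef) : IsUnit N.det := by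
  rw [isUnit_iff_ne_zero]
  intro h0
  obtain ⟨v, hv, hN⟩ := exists_mulVec_eq_zero_iff.2 h0
  have := h.dotProduct_mulVec_pos hv
  rw [add_mulVec, hN, zero_add, mulVec_transpose, star_trivial, dotProduct_comm,
    ← dotProduct_mulVec, hN] at this
  simp at this

lemma isUnit_det_of_negDef_sym {n : ℕ} {N : Matrix (Fin n) (Fin n) ℝ} (h : NegDef (sym N)) :
    IsUnit N.det := by
  have h' : (-N + (-N)ᵀ).PosDef := by
    rw [transpose_neg, ← neg_add, add_comm]; exact h
  have := isUnit_det_of_posDef_add_transpose h'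
  rw [det_neg] at this
  exact isUnit_of_mul_isUnit_right this

lemma exists_detPencil_eq_charpoly {n : ℕ} {a b : Type*} [Fintype a] [DecidableEq a] [Fintype b]
    [DecidableEq b] {W : Matrix (Fin n) (a ⊕ b) ℝ} {W' : Matrix (a ⊕ b) (Fin n) ℝ}
    {S : Matrix (a ⊕ b) (Fin n) ℝ} {S' : Matrix (Fin n) (a ⊕ b) ℝ}
    (hW : IsInversePair W W') (hS : IsInversePair S S') (Ar : Matrix a a ℝ) :
    ∃ d : ℝ, d ≠ 0 ∧ detPencil (W * (fromBlocks 1 0 0 0 : Matrix (a ⊕ b) (a ⊕ b) ℝ) * S)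
      (W * (fromBlocks Ar 0 0 1 : Matrix (a ⊕ b) (a ⊕ b) ℝ) * S) = C d * Ar.charpoly := by
  obtain ⟨d, hd, h⟩ := exists_pencilPoly_mul_mul hW hS (fromBlocks 1 0 0 0) (fromBlocks Ar 0 0 1)
  refine ⟨d * (-1 : Matrix b b ℝ).det, mul_ne_zero hd ?_, ?_⟩
  · simp [det_neg]
  · refine h.trans ?_
    rw [pencilPoly_fromBlocks_of_isUnit _ _ _ (by simp), C_mul, mul_assoc]
    simp

lemma isImpulseFree_of_isUnit {n : ℕ} {a b : Type*} [Fintype a] [DecidableEq a] [Fintype b]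
    [DecidableEq b] {E A : Matrix (Fin n) (Fin n) ℝ}
    {U : Matrix (Fin n) (a ⊕ b) ℝ} {U' : Matrix (a ⊕ b) (Fin n) ℝ}
    {V : Matrix (a ⊕ b) (Fin n) ℝ} {V' : Matrix (Fin n) (a ⊕ b) ℝ}
    (hU : IsInversePair U U') (hV : IsInversePair V V') (hcard : Fintype.card a = E.rank)
    (hE : E = U * (fromBlocks 1 0 0 0 : Matrix (a ⊕ b) (a ⊕ b) ℝ) * V)
    (h : IsUnit (U' * A * V').toBlocks₂₂.det) : IsImpulseFree E A := by
  obtain ⟨W, W', S, S', Ar, hW, hS, e1, e2⟩ := exists_weierstrass_form hU hV A h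
  obtain ⟨d, hd, hp⟩ := exists_detPencil_eq_charpoly hW hS Ar
  rw [← e1, ← hE, ← e2] at hp
  rw [IsImpulseFree, hp, degree_C_mul hd, charpoly_degree_eq_dim, hcard]

lemma IsImpulseFree.isUnit {n : ℕ} {a b : Type*} [Fintype a] [DecidableEq a] [Fintype b]
    [DecidableEq b] {E A : Matrix (Fin n) (Fin n) ℝ}
    {U : Matrix (Fin n) (a ⊕ b) ℝ} {U' : Matrix (a ⊕ b) (Fin n) ℝ}
    {V : Matrix (a ⊕ b) (Fin n) ℝ} {V' : Matrix (Fin n) (a ⊕ b) ℝ}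
    (hU : IsInversePair U U') (hV : IsInversePair V V') (hcard : Fintype.card a = E.rank)
    (hE : E = U * (fromBlocks 1 0 0 0 : Matrix (a ⊕ b) (a ⊕ b) ℝ) * V)
    (h : IsImpulseFree E A) : IsUnit (U' * A * V').toBlocks₂₂.det := by
  have hA : A = U * (U' * A * V') * V := by
    have : U * (U' * A * V') * V = (U * U') * A * (V' * V) := by simp only [Matrix.mul_assoc]
    rw [this, hU.mul_inv, hV.inv_mul, Matrix.one_mul, Matrix.mul_one]
  obtain ⟨d, hd, hp⟩ := exists_pencilPoly_mul_mul hU hV (fromBlocks 1 0 0 0) (U' * A * V')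
  rw [← hE, ← hA] at hp
  have hp : detPencil E A = _ := hp
  rw [IsImpulseFree, hp, degree_C_mul hd, ← hcard, ← fromBlocks_toBlocks (U' * A * V')] at h
  exact isUnit_iff_ne_zero.2 (det_ne_zero_of_degree_pencilPoly h)

lemma IsImpulseFree.isRegular {n : ℕ} {E A : Matrix (Fin n) (Fin n) ℝ} (h : IsImpulseFree E A) :
    IsRegular E A := by
  by_contra hcon
  simp only [IsRegular, not_exists, not_not, aeval_def, eval₂_eq_eval_map] at hcon
  have h0 : (detPencil E A).map (algebraMap ℝ ℂ) = 0 := Polynomial.funext (by simpa using hcon)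
  rw [Polynomial.map_eq_zero] at h0
  rw [IsImpulseFree, h0, degree_zero] at h
  exact absurd h (by simp)

lemma aeval_detPencil {n : ℕ} (E A : Matrix (Fin n) (Fin n) ℝ) (z : ℂ) :
    aeval z (detPencil E A) = (z • E.map Complex.ofReal - A.map Complex.ofReal).det := by
  rw [detPencil, AlgHom.map_det]
  congr 1
  ext i j
  simp only [map_sub, AlgHom.mapMatrix_apply, Matrix.sub_apply, Matrix.map_apply, Matrix.smul_apply,
    smul_eq_mul, map_mul, aeval_X, aeval_C]
  rfl

/-- A descriptor pair satisfying the descriptor Lyapunov inequality is impulse free. -/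
lemma isImpulseFree_of_negDef {n k : ℕ} {E A : Matrix (Fin n) (Fin n) ℝ}
    {E₂ : Matrix (Fin k) (Fin n) ℝ} (hE₂ : E₂ * E = 0) {P : Matrix (Fin n) (Fin n) ℝ}
    {Q : Matrix (Fin n) (Fin k) ℝ} (h : NegDef (sym ((Eᵀ * P + Q * E₂) * A))) :
    IsImpulseFree E A := by
  obtain ⟨a, b, _, _, _, _, U, U', V, V', hU, hV, hcard, hE⟩ := exists_rank_normal_form E
  refine isImpulseFree_of_isUnit hU hV hcard hE (isUnit_iff_ne_zero.2 fun h0 => ?_)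
  -- A kernel vector of the lower right block yields `v ≠ 0` with `E v = 0` and `A v = E u` for some
  -- `u`. Then `vᵀ (Eᵀ P + Q E₂) A v = (E v)ᵀ P E u = 0`, contradicting definiteness.
  obtain ⟨w, hw, hw0⟩ := exists_mulVec_eq_zero_iff.2 h0
  set K := U' * A * V' with hK
  have hAV : A * V' = U * K := by
    rw [hK, ← Matrix.mul_assoc, ← Matrix.mul_assoc, hU.mul_inv, Matrix.one_mul]
  clear_value K
  have hEV : E * V' = U * (fromBlocks 1 0 0 0 : Matrix (a ⊕ b) (a ⊕ b) ℝ) := by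
    rw [hE, Matrix.mul_assoc, hV.mul_inv, Matrix.mul_one]
  set v := V' *ᵥ Sum.elim 0 w with hv
  have hv0 : v ≠ 0 := by
    intro hv0
    have : V *ᵥ v = Sum.elim (0 : a → ℝ) w := by rw [hv, mulVec_mulVec, hV.mul_inv, one_mulVec]
    rw [hv0, mulVec_zero] at this
    exact hw (funext fun i => (congrFun this (Sum.inr i)).symm)
  have hEv : E *ᵥ v = 0 := by
    rw [hv, mulVec_mulVec, hEV, ← mulVec_mulVec, fromBlocks_mulVec]
    simp
  have hAv : A *ᵥ v = E *ᵥ (V' *ᵥ Sum.elim (K.toBlocks₁₂ *ᵥ w) 0) := by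
    rw [hv, mulVec_mulVec, hAV, ← mulVec_mulVec, mulVec_mulVec _ E, hEV, ← mulVec_mulVec]
    congr 1
    rw [← fromBlocks_toBlocks K, fromBlocks_mulVec, fromBlocks_mulVec]
    simp [hw0]
  have hq : v ⬝ᵥ (((Eᵀ * P + Q * E₂) * A) *ᵥ v) = 0 := by
    rw [← mulVec_mulVec, hAv, add_mulVec, ← mulVec_mulVec _ Q, mulVec_mulVec _ E₂, hE₂, zero_mulVec,
      mulVec_zero, add_zero, ← mulVec_mulVec, dotProduct_mulVec, vecMul_transpose, hEv,
      zero_dotProduct]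
  have := h.dotProduct_mulVec_pos hv0
  rw [sym, neg_mulVec, add_mulVec, mulVec_transpose, star_trivial, dotProduct_neg, dotProduct_add,
    hq, dotProduct_comm, ← dotProduct_mulVec, hq] at this
  simp at this

open scoped ComplexOrder in
-- If `A v = z E v` and `y = E v`, the form at `v` is `q = z (c s + c̄ t)`, where `s = y* Z y` and
-- `t = y* Zᵀ y` are nonnegative reals. Negativity of `Re q` puts `z` in one of the half planes.
lemma isStable_of_negDef {n k : ℕ} {α : ℝ} (hα0 : 0 < α) (hα1 : α ≤ 1)
    {E A : Matrix (Fin n) (Fin n) ℝ}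
    {E₂ : Matrix (Fin k) (Fin n) ℝ} (hE₂ : E₂ * E = 0) {P : Matrix (Fin n) (Fin n) ℝ}
    (hP : P ∈ fracPosDef n α)
    {Q : Matrix (Fin n) (Fin k) ℝ} (h : NegDef (sym ((Eᵀ * P + Q * E₂) * A))) :
    IsStable α E A := by
  intro z hz
  have hpi := Real.pi_pos
  rw [lt_abs_arg_iff (by positivity) (by nlinarith)]
  obtain ⟨Z, hZ, hPZ⟩ := mem_fracPosDef_iff.1 hP
  set c : ℂ := ⟨Real.sin (α * Real.pi / 2), Real.cos (α * Real.pi / 2)⟩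
  by_contra! hcon
  rw [aeval_detPencil] at hz
  obtain ⟨v, hv0, hv⟩ := exists_mulVec_eq_zero_iff.2 hz
  have hAv : A.map Complex.ofReal *ᵥ v = z • (E.map Complex.ofReal *ᵥ v) := by
    rw [sub_mulVec, sub_eq_zero, smul_mulVec] at hv
    exact hv.symm
  set M := Eᵀ * P + Q * E₂ with hM
  have hME : M * E = Eᵀ * P * E := by
    rw [hM, Matrix.add_mul, Matrix.mul_assoc Q, hE₂, Matrix.mul_zero, add_zero]
  set y := E.map Complex.ofReal *ᵥ v with hy
  set q := star v ⬝ᵥ ((M * A).map Complex.ofReal *ᵥ v) with hq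
  have hqz : q = z * (c * (star y ⬝ᵥ (Z *ᵥ y)) + star c * (star y ⬝ᵥ (Zᵀ *ᵥ y))) := by
    have hEH : Eᵀ.map Complex.ofReal = (E.map Complex.ofReal)ᴴ := by ext i j; simp
    rw [hq, map_ofReal_mul, ← mulVec_mulVec, hAv, mulVec_smul, hy, mulVec_mulVec,
      ← map_ofReal_mul, hME, map_ofReal_mul, map_ofReal_mul, hPZ, hEH, ← mulVec_mulVec,
      ← mulVec_mulVec, dotProduct_smul, dotProduct_mulVec, ← star_mulVec, add_mulVec,
      dotProduct_add, smul_mulVec, smul_mulVec, dotProduct_smul, dotProduct_smul]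
    simp only [smul_eq_mul]
  have hpos := (posDef_map_ofReal_iff.2 h).dotProduct_mulVec_pos hv0
  have e : (-sym (M * A)).map Complex.ofReal =
      -(((M * A).map Complex.ofReal)ᴴ + (M * A).map Complex.ofReal) := by
    ext i j; simp [sym, -transpose_mul]
  rw [e, neg_mulVec, add_mulVec, dotProduct_neg, dotProduct_add, ← hq] at hpos
  have e2 : star v ⬝ᵥ (((M * A).map Complex.ofReal)ᴴ *ᵥ v) = star q := by
    rw [hq, star_dotProduct, star_mulVec, ← dotProduct_mulVec, conjTranspose_conjTranspose]
  rw [e2] at hpos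
  have hre := (Complex.pos_iff.1 hpos).1
  have ha := Complex.nonneg_iff.1 (hZ.posSemidef.dotProduct_mulVec_nonneg y)
  have hb := Complex.nonneg_iff.1 (hZ.transpose.posSemidef.dotProduct_mulVec_nonneg y)
  generalize star y ⬝ᵥ (Z *ᵥ y) = s at *
  generalize star y ⬝ᵥ (Zᵀ *ᵥ y) = t at *
  have hqre : q.re = s.re * (c * z).re + t.re * (star c * z).re := by
    rw [hqz]
    simp [Complex.mul_re, Complex.mul_im, ← ha.2, ← hb.2]
    ring
  have : 0 ≤ q.re := by
    rw [hqre]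
    exact add_nonneg (mul_nonneg ha.1 hcon.1) (mul_nonneg hb.1 hcon.2)
  simp at hre
  linarith

lemma isAdmissible_of_negDef {n k : ℕ} {α : ℝ} (hα0 : 0 < α) (hα1 : α ≤ 1)
    {E A : Matrix (Fin n) (Fin n) ℝ}
    {E₂ : Matrix (Fin k) (Fin n) ℝ} (hE₂ : E₂ * E = 0) {P : Matrix (Fin n) (Fin n) ℝ}
    (hP : P ∈ fracPosDef n α)
    {Q : Matrix (Fin n) (Fin k) ℝ} (h : NegDef (sym ((Eᵀ * P + Q * E₂) * A))) :
    IsAdmissible α E A :=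
  ⟨(isImpulseFree_of_negDef hE₂ h).isRegular, isImpulseFree_of_negDef hE₂ h,
    isStable_of_negDef hα0 hα1 hE₂ hP h⟩

lemma IsAdmissible.exists_negDef_left {n k : ℕ} {α : ℝ} (hα0 : 0 < α) (hα1 : α ≤ 1)
    {E A : Matrix (Fin n) (Fin n) ℝ} {E₂ : Matrix (Fin k) (Fin n) ℝ} (hE₂ : E₂ * E = 0)
    (hrank : E.rank + E₂.rank = n) (h : IsAdmissible α E A) :
    ∃ P ∈ fracPosDef n α, ∃ Q : Matrix (Fin n) (Fin k) ℝ,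
      NegDef (sym ((Eᵀ * P + Q * E₂) * A)) := by
  obtain ⟨a, b, _, _, _, _, U, U', V, V', hU, hV, hcard, hE⟩ := exists_rank_normal_form E
  obtain ⟨W, W', S, S', Ar, hW, hS, e1, e2⟩ :=
    exists_weierstrass_form hU hV A (IsImpulseFree.isUnit hU hV hcard hE h.2.1)
  rw [← hE] at e1
  obtain ⟨d, hd, hp⟩ := exists_detPencil_eq_charpoly hW hS Ar
  rw [← e1, ← e2] at hp
  have hpi := Real.pi_pos
  obtain ⟨P₁, hP₁, hL⟩ := exists_twoRayPosDef_lyapunov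
    (c := ⟨Real.sin (α * Real.pi / 2), Real.cos (α * Real.pi / 2)⟩) Ar (fun z hz => by
      rw [← lt_abs_arg_iff (by positivity) (by nlinarith)]
      refine h.2.2 z ?_
      rw [hp, map_mul, aeval_def z Ar.charpoly, eval₂_eq_eval_map]
      have : (Ar.map Complex.ofReal).charpoly = Ar.charpoly.map (algebraMap ℝ ℂ) :=
        charpoly_map Ar (algebraMap ℝ ℂ)
      rw [← this, hz.eq_zero, mul_zero])
  set c : ℂ := ⟨Real.sin (α * Real.pi / 2), Real.cos (α * Real.pi / 2)⟩
  -- The lower block is invisible to `Eᵀ P`, so any member of the class will do; `c + c̄ = 2 Re c`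
  -- comes from `Z = I`.
  set P := W'ᵀ * (fromBlocks P₁ 0 0 ((2 * c.re) • 1) : Matrix (a ⊕ b) (a ⊕ b) ℝ) * W' with hPdef
  have hP : TwoRayPosDef c P := (hP₁.fromBlocks_diag twoRayPosDef_smul_one).congr hW.mul_inv
  have hWt : Wᵀ * W'ᵀ = 1 := by rw [← transpose_mul, hW.inv_mul, transpose_one]
  have hEP : Eᵀ * P = Sᵀ * (fromBlocks P₁ 0 0 0 : Matrix (a ⊕ b) (a ⊕ b) ℝ) * W' := by
    have : Eᵀ * P = Sᵀ * ((fromBlocks 1 0 0 0 : Matrix (a ⊕ b) (a ⊕ b) ℝ)ᵀ * (Wᵀ * W'ᵀ) *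
        fromBlocks P₁ 0 0 ((2 * c.re) • 1)) * W' := by
      rw [hPdef, e1, transpose_mul, transpose_mul]
      simp only [Matrix.mul_assoc]
    rw [this, hWt, fromBlocks_transpose, Matrix.mul_one, fromBlocks_multiply]
    simp
  -- `Q` is chosen so that `Q E₂` contributes `-I` on the algebraic block, where `A` acts as the
  -- identity.
  obtain ⟨Q, hQ⟩ := exists_eq_mul_of_mul_eq_zero (by simpa using hrank) hE₂
    (M := Sᵀ * (fromBlocks 0 0 0 (-1) : Matrix (a ⊕ b) (a ⊕ b) ℝ) * W') (by
      have : Sᵀ * (fromBlocks 0 0 0 (-1) : Matrix (a ⊕ b) (a ⊕ b) ℝ) * W' * E =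
          Sᵀ * ((fromBlocks 0 0 0 (-1) : Matrix (a ⊕ b) (a ⊕ b) ℝ) * (W' * W) *
            fromBlocks 1 0 0 0) * S := by
        rw [e1]; simp only [Matrix.mul_assoc]
      rw [this, hW.inv_mul, Matrix.mul_one, fromBlocks_multiply]
      simp)
  refine ⟨P, mem_fracPosDef_iff.2 hP, Q, ?_⟩
  have hMA : (Eᵀ * P + Q * E₂) * A =
      Sᵀ * (fromBlocks (P₁ * Ar) 0 0 (-1) : Matrix (a ⊕ b) (a ⊕ b) ℝ) * S := by
    have h1 : Eᵀ * P + Q * E₂ =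
        Sᵀ * (fromBlocks P₁ 0 0 (-1) : Matrix (a ⊕ b) (a ⊕ b) ℝ) * W' := by
      rw [hEP, ← hQ, ← Matrix.add_mul, ← Matrix.mul_add, fromBlocks_add]
      simp
    have h2 : Sᵀ * (fromBlocks P₁ 0 0 (-1) : Matrix (a ⊕ b) (a ⊕ b) ℝ) * W' * A =
        Sᵀ * ((fromBlocks P₁ 0 0 (-1) : Matrix (a ⊕ b) (a ⊕ b) ℝ) * (W' * W) *
          fromBlocks Ar 0 0 1) * S := by
      rw [e2]; simp only [Matrix.mul_assoc]
    rw [h1, h2, hW.inv_mul, Matrix.mul_one, fromBlocks_multiply]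
    simp
  have hpd := posDef_congr (posDef_fromBlocks_diag hL
    ((PosDef.one : (1 : Matrix b b ℝ).PosDef).add PosDef.one)) hS.inv_mul
  rw [NegDef, hMA]
  convert! hpd using 1
  rw [sym, transpose_mul, transpose_mul, transpose_transpose,
    conjTranspose_eq_transpose_of_trivial, ← Matrix.mul_assoc, ← Matrix.add_mul, ← Matrix.mul_add,
    fromBlocks_transpose, fromBlocks_add, ← Matrix.neg_mul, ← Matrix.mul_neg, fromBlocks_neg]
  simp [add_comm]

lemma detPencil_transpose {n : ℕ} (E A : Matrix (Fin n) (Fin n) ℝ) :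
    detPencil Eᵀ Aᵀ = detPencil E A := by
  unfold detPencil
  rw [← det_transpose]
  congr 1

lemma IsAdmissible.transpose {n : ℕ} {α : ℝ} {E A : Matrix (Fin n) (Fin n) ℝ}
    (h : IsAdmissible α E A) : IsAdmissible α Eᵀ Aᵀ := by
  unfold IsAdmissible IsRegular IsImpulseFree IsStable at *
  rwa [detPencil_transpose, rank_transpose]

lemma IsAdmissible.exists_negDef_right {n k : ℕ} {α : ℝ} (hα0 : 0 < α) (hα1 : α ≤ 1)
    {E A : Matrix (Fin n) (Fin n) ℝ} {E₁ : Matrix (Fin n) (Fin k) ℝ} (hE₁ : E * E₁ = 0)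
    (hrank : E.rank + E₁.rank = n) (h : IsAdmissible α E A) :
    ∃ X ∈ fracPosDef n α, ∃ Y : Matrix (Fin k) (Fin n) ℝ,
      NegDef (sym (A * (X * Eᵀ + E₁ * Y))) := by
  obtain ⟨P, hP, Q, hPQ⟩ := h.transpose.exists_negDef_left hα0 hα1 (E₂ := E₁ᵀ)
    (by rw [← transpose_mul, hE₁, transpose_zero]) (by rwa [rank_transpose, rank_transpose])
  refine ⟨Pᵀ, mem_fracPosDef_iff.2 (mem_fracPosDef_iff.1 hP).transpose, Qᵀ, ?_⟩
  have : sym (A * (Pᵀ * Eᵀ + E₁ * Qᵀ)) = sym ((Eᵀᵀ * P + Q * E₁ᵀ) * Aᵀ) := by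
    simp only [sym, transpose_mul, transpose_add, transpose_transpose]
    abel
  rwa [this]

/-! ### The output feedback inequality. -/

lemma OutputFeedbackLMI.isUnit_det {n m p k : ℕ} {E A : Matrix (Fin n) (Fin n) ℝ}
    {B : Matrix (Fin n) (Fin m) ℝ} {C : Matrix (Fin p) (Fin n) ℝ}
    {E₂ : Matrix (Fin k) (Fin n) ℝ} {K₀ : Matrix (Fin m) (Fin n) ℝ}
    {P : Matrix (Fin n) (Fin n) ℝ} {Q : Matrix (Fin n) (Fin k) ℝ}
    {G : Matrix (Fin m) (Fin m) ℝ} {H : Matrix (Fin m) (Fin p) ℝ}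
    (h : OutputFeedbackLMI E A B C E₂ K₀ P Q G H) : IsUnit G.det := by
  have := PosDef.submatrix h (e := Sum.inr) Sum.inr_injective
  refine isUnit_det_of_posDef_add_transpose ?_
  convert! this using 1
  ext i j
  simp
  ring

lemma OutputFeedbackLMI.negDef {n m p k : ℕ} {E A : Matrix (Fin n) (Fin n) ℝ}
    {B : Matrix (Fin n) (Fin m) ℝ} {C : Matrix (Fin p) (Fin n) ℝ}
    {E₂ : Matrix (Fin k) (Fin n) ℝ} {K₀ : Matrix (Fin m) (Fin n) ℝ}
    {P : Matrix (Fin n) (Fin n) ℝ} {Q : Matrix (Fin n) (Fin k) ℝ}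
    {G : Matrix (Fin m) (Fin m) ℝ} {H F : Matrix (Fin m) (Fin p) ℝ}
    (h : OutputFeedbackLMI E A B C E₂ K₀ P Q G H) (hF : F = G⁻¹ * H) :
    NegDef (sym ((Eᵀ * P + Q * E₂) * (A + B * F * C))) := by
  have hH : H = G * F := by rw [hF, mul_nonsing_inv_cancel_left _ _ h.isUnit_det]
  -- With `W = FC - K₀` and `H = G F`, the off-diagonal block is `(Eᵀ P + Q E₂) B + Wᵀ Gᵀ`. After
  -- the congruence the terms `Wᵀ (G + Gᵀ) W` cancel in the upper left block.
  have hT : (fromBlocks 1 0 (-(F * C - K₀)) 1 : Matrix (Fin n ⊕ Fin m) (Fin n ⊕ Fin m) ℝ) *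
      fromBlocks 1 0 (F * C - K₀) 1 = 1 := by
    rw [fromBlocks_multiply]; simp
  have := (posDef_congr h hT).submatrix (e := Sum.inl) Sum.inl_injective
  rw [NegDef]
  convert! this using 1
  have hR : (Eᵀ * P + Q * E₂) * B + Cᵀ * Hᵀ - K₀ᵀ * Gᵀ =
      (Eᵀ * P + Q * E₂) * B + (F * C - K₀)ᵀ * Gᵀ := by
    rw [hH, transpose_sub, transpose_mul, transpose_mul, Matrix.sub_mul, Matrix.mul_assoc Cᵀ]
    abel
  have hPhi : Phi E A B E₂ K₀ P Q = sym ((Eᵀ * P + Q * E₂) * (A + B * K₀)) := by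
    rw [Phi, ← Matrix.add_mul]
  have hA : A + B * F * C = A + B * K₀ + B * (F * C - K₀) := by
    rw [Matrix.mul_sub, Matrix.mul_assoc]; abel
  rw [hR, hPhi, hA, conjTranspose_eq_transpose_of_trivial, fromBlocks_neg, fromBlocks_transpose,
    fromBlocks_multiply, fromBlocks_multiply]
  generalize F * C - K₀ = W
  generalize Eᵀ * P + Q * E₂ = M
  generalize A + B * K₀ = A'
  ext i j
  rw [submatrix_apply, fromBlocks_apply₁₁]
  revert i j
  rw [Matrix.ext_iff]
  simp only [sym, transpose_mul, transpose_add, transpose_one, transpose_transpose,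
    Matrix.mul_add, Matrix.add_mul, Matrix.mul_neg, Matrix.neg_mul, Matrix.mul_sub, Matrix.sub_mul,
    Matrix.one_mul, Matrix.mul_one, Matrix.mul_assoc, neg_add, neg_sub]
  abel

lemma exists_outputFeedbackLMI {n m p k : ℕ} {E A : Matrix (Fin n) (Fin n) ℝ}
    {B : Matrix (Fin n) (Fin m) ℝ} {C : Matrix (Fin p) (Fin n) ℝ}
    {E₂ : Matrix (Fin k) (Fin n) ℝ} {P : Matrix (Fin n) (Fin n) ℝ} {Q : Matrix (Fin n) (Fin k) ℝ}
    {F : Matrix (Fin m) (Fin p) ℝ}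
    (h : NegDef (sym ((Eᵀ * P + Q * E₂) * (A + B * F * C)))) :
    ∃ (G : Matrix (Fin m) (Fin m) ℝ) (H : Matrix (Fin m) (Fin p) ℝ),
      OutputFeedbackLMI E A B C E₂ (F * C) P Q G H ∧ F = G⁻¹ * H := by
  obtain ⟨g, hg, hG⟩ := exists_posDef_fromBlocks_real h (-((Eᵀ * P + Q * E₂) * B))
  have hu : IsUnit ((g / 2) • (1 : Matrix (Fin m) (Fin m) ℝ)).det := by
    rw [det_smul, det_one, mul_one, isUnit_iff_ne_zero]; positivity
  -- Half of `g`, since the corner of the inequality is `G + Gᵀ` up to sign.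
  refine ⟨(g / 2) • 1, (g / 2) • (1 : Matrix (Fin m) (Fin m) ℝ) * F, ?_, ?_⟩
  · rw [OutputFeedbackLMI, NegDef]
    convert! hG using 1
    have hR : (Eᵀ * P + Q * E₂) * B +
        Cᵀ * ((g / 2) • (1 : Matrix (Fin m) (Fin m) ℝ) * F)ᵀ -
        (F * C)ᵀ * ((g / 2) • (1 : Matrix (Fin m) (Fin m) ℝ))ᵀ = (Eᵀ * P + Q * E₂) * B := by
      simp [transpose_mul]
    rw [hR, fromBlocks_neg, Phi, ← Matrix.add_mul, Matrix.mul_assoc B F C, transpose_neg]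
    congr 1
    rw [transpose_smul, transpose_one, neg_sub, sub_neg_eq_add, ← add_smul, add_halves]
  · rw [nonsing_inv_mul_cancel_left _ _ hu]

end SingularFOS

theorem theorem3 {n m p r : ℕ} (α : ℝ) (hα0 : 0 < α) (hα1 : α ≤ 1)
    (E A : Matrix (Fin n) (Fin n) ℝ) (B : Matrix (Fin n) (Fin m) ℝ)
    (C : Matrix (Fin p) (Fin n) ℝ) (hE : E.rank = r) (hr : r < n)
    (E₁ : Matrix (Fin n) (Fin (n - r)) ℝ) (hE₁_rank : E₁.rank = n - r) (hE₁ : E * E₁ = 0)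
    (E₂ : Matrix (Fin (n - r)) (Fin n) ℝ) (hE₂_rank : E₂.rank = n - r) (hE₂ : E₂ * E = 0) :
    (∀ F : Matrix (Fin m) (Fin p) ℝ,
      SingularFOS.IsAdmissible α E (A + B * F * C) ↔
        ∃ X ∈ SingularFOS.fracPosDef n α, ∃ (Y : Matrix (Fin (n - r)) (Fin n) ℝ)
          (Z K₀ : Matrix (Fin m) (Fin n) ℝ),
          SingularFOS.StateFeedbackLMI E A B E₁ X Y Z ∧
          IsUnit (X * Eᵀ + E₁ * Y).det ∧
          K₀ = Z * (X * Eᵀ + E₁ * Y)⁻¹ ∧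
          ∃ P ∈ SingularFOS.fracPosDef n α, ∃ (Q : Matrix (Fin n) (Fin (n - r)) ℝ)
            (G : Matrix (Fin m) (Fin m) ℝ) (H : Matrix (Fin m) (Fin p) ℝ),
            SingularFOS.OutputFeedbackLMI E A B C E₂ K₀ P Q G H ∧
            F = G⁻¹ * H) ∧
    (∀ (K₀ : Matrix (Fin m) (Fin n) ℝ) (P : Matrix (Fin n) (Fin n) ℝ)
      (Q : Matrix (Fin n) (Fin (n - r)) ℝ) (G : Matrix (Fin m) (Fin m) ℝ)
      (H : Matrix (Fin m) (Fin p) ℝ),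
      SingularFOS.OutputFeedbackLMI E A B C E₂ K₀ P Q G H → IsUnit G.det) := by
  refine ⟨fun F => ⟨fun h => ?_, ?_⟩, fun K₀ P Q G H h => h.isUnit_det⟩
  · obtain ⟨X, hX, Y, hXY⟩ := h.exists_negDef_right hα0 hα1 hE₁ (by omega)
    obtain ⟨P, hP, Q, hPQ⟩ := h.exists_negDef_left hα0 hα1 hE₂ (by omega)
    obtain ⟨G, H, hGH, hF⟩ := SingularFOS.exists_outputFeedbackLMI hPQ
    have hu : IsUnit (X * Eᵀ + E₁ * Y).det := by
      have := SingularFOS.isUnit_det_of_negDef_sym hXY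
      rw [det_mul] at this
      exact isUnit_of_mul_isUnit_right this
    -- This `Z` makes the intermediate gain exactly `F C`, and the state feedback inequality becomes
    -- the dual Lyapunov inequality of the closed loop.
    refine ⟨X, hX, Y, F * C * (X * Eᵀ + E₁ * Y), F * C, ?_, hu, ?_, P, hP, Q, G, H, hGH, hF⟩
    · rw [SingularFOS.StateFeedbackLMI]
      convert! hXY using 2
      simp only [Matrix.add_mul, Matrix.mul_add, Matrix.mul_assoc]
      abel
    · rw [mul_nonsing_inv_cancel_right _ _ hu]
  · rintro ⟨X, -, Y, Z, K₀, -, -, -, P, hP, Q, G, H, h, hF⟩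
    exact SingularFOS.isAdmissible_of_negDef hα0 hα1 hE₂ hP (h.negDef hF)
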